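/- Let $V$ be a finite-dimensional real vector space. Call a linear endomorphism $T$ of a finite-dimensional real vector space $W$ *semisimple* if its complex-linear extension to $W_{\mathbb C}=W\otimes_{\mathbb R}\mathbb C$ is diagonalizable; *elliptic* (respectively *hyperbolic*) if it is semisimple and all eigenvalues of this extension are purely imaginary, $0$ being allowed (respectively real); and *nilpotent* if $T^n=0$ for some $n\in\mathbb N$. A *usual (linear) Jordan decomposition* of $X\in\mathfrak{gl}(V)$ is an expression $X=E+H+N$ with pairwise commuting $E,H,N\in\mathfrak{gl}(V)$ such that $E$ is elliptic, $H$ is hyperbolic and $N$ is nilpotent. An *abstract Jordan decomposition* of an element $X$ of a finite-dimensional real Lie algebra $\mathfrak g$ is an expression $X=E+H+N$ with pairwise commuting $E,H,N\in\mathfrak g$ such that the endomorphisms $\mathrm{ad}(E)$, $\mathrm{ad}(H)$, $\mathrm{ad}(N)$ of $\mathfrak g$ are elliptic, hyperbolic and nilpotent, respectively. **Corollary.** Let $\mathfrak g\subset\mathfrak{gl}(V)$ be a semisimple real Lie subalgebra (that is, its radical, the largest solvable ideal, is zero), and let $X\in\mathfrak g$. Then the abstract and the usual Jordan decompositions of $X$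 coincide: for $E,H,N\in\mathfrak{gl}(V)$, $X=E+H+N$ is a usual Jordan decomposition of $X$ if and only if $E,H,N\in\mathfrak g$ and $X=E+H+N$ is an abstract Jordan decomposition of $X$ in $\mathfrak g$. Moreover, $X$ has exactly one usual Jordan decomposition and exactly one abstract Jordan decomposition; in particular, the abstract Jordan decomposition exists. -/

import Mathlib

open scoped TensorProduct

/- The commutator bracket `⁅S, T⁆ = S * T - T * S` makes `gl(V) = Module.End ℝ V` a Lie ring. -/
attribute [local instance 100] LieRing.ofAssociativeRing

section LinearMaps

variable {V : Type*} [AddCommGroup V] [Module ℝ V]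

/-- The complexification `V_ℂ → V_ℂ` of a real linear map `T : V → V`, where `V_ℂ = ℂ ⊗ V`. -/
noncomputable def complexify (T : Module.End ℝ V) : Module.End ℂ (ℂ ⊗[ℝ] V) :=
  LinearMap.baseChange ℂ T

/-- `T` is semisimple: it is diagonalizable in `V_ℂ`, i.e. `V_ℂ` is spanned by eigenvectors. -/
def IsSemisimpleMap (T : Module.End ℝ V) : Prop :=
  ⨆ μ : ℂ, (complexify T).eigenspace μ = ⊤

/-- `T` is (additively) elliptic: semisimple with purely imaginary eigenvalues
(zero is allowed as an eigenvalue). -/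
def IsEllipticMap (T : Module.End ℝ V) : Prop :=
  IsSemisimpleMap T ∧ ∀ μ : ℂ, (complexify T).HasEigenvalue μ → μ.re = 0

/-- `T` is (additively) hyperbolic: semisimple with real eigenvalues. -/
def IsHyperbolicMap (T : Module.End ℝ V) : Prop :=
  IsSemisimpleMap T ∧ ∀ μ : ℂ, (complexify T).HasEigenvalue μ → μ.im = 0

/-- `X = E + H + N` is the usual (linear, additive) Jordan decomposition of `X` in `gl(V)`:
the maps `E`, `H`, `N` commute, `E` is elliptic, `H` is hyperbolic and `N` is nilpotent. -/
structure IsLinearJordanDecomposition (X E H N : Module.End ℝ V) : Prop where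
  sum_eq : X = E + H + N
  commute_EH : Commute E H
  commute_EN : Commute E N
  commute_HN : Commute H N
  elliptic : IsEllipticMap E
  hyperbolic : IsHyperbolicMap H
  nilpotent : IsNilpotent N

end LinearMaps

/-- `X = E + H + N` is an abstract Jordan decomposition of `X` in the real Lie algebra `𝔤`:
the elements `E`, `H`, `N` of `𝔤` commute, and the endomorphisms `ad E`, `ad H`, `ad N` of the
real vector space `𝔤` are elliptic, hyperbolic and nilpotent, respectively. -/
structure IsAbstractJordanDecomposition {𝔤 : Type*} [LieRing 𝔤] [LieAlgebra ℝ 𝔤]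
    (X E H N : 𝔤) : Prop where
  sum_eq : X = E + H + N
  commute_EH : ⁅E, H⁆ = 0
  commute_EN : ⁅E, N⁆ = 0
  commute_HN : ⁅H, N⁆ = 0
  elliptic : IsEllipticMap (LieAlgebra.ad ℝ 𝔤 E)
  hyperbolic : IsHyperbolicMap (LieAlgebra.ad ℝ 𝔤 H)
  nilpotent : IsNilpotent (LieAlgebra.ad ℝ 𝔤 N)

/-!
The proof constructs the abstract Jordan decomposition first and shows that every representation
of `𝔤` turns it into a linear one. Uniqueness of the linear decomposition then gives everything else.

Existence in `𝔤`. The linear Jordan decomposition of `ad X` exists over `ℝ`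
(`exists_isLinearJordanDecomposition`); after complexification its elliptic and hyperbolic parts act
on the generalized `μ`-eigenspace of `ad X` as `i im μ` and `re μ`. Both are additive in `μ`, and the
generalized eigenspaces grade the Lie algebra, so the parts are derivations. By Cartan's criterion
the Killing form of `𝔤` is nondegenerate, so all derivations are inner
(`exists_isAbstractJordanDecomposition`). Uniqueness follows since `ad` is injective.

Passage to representations (`IsAbstractJordanDecomposition.toEnd`). Two facts about a complex Lie
algebra with nondegenerate Killing form are needed, applied to `ℂ ⊗ 𝔤`
(`LieAlgebra.IsKilling.baseChange`); neither uses complete reducibility.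

* If `ad s` is semisimple, then `s` acts semisimply on every finite-dimensional module
  (`LieModule.isSemisimple_toEnd_of_isSemisimple_ad`). Such an `s` lies in a Cartan subalgebra, which
  is abelian and spanned by coroots, so it suffices to treat the element `h` of an `sl₂`-triple
  acting on the module (`IsSl2Triple.isSemisimple_of_isNilpotent`). The nilpotent part `n` of `h`
  commutes with the triple, while a product of exponentials of `e` and `f` conjugates `h` to `-h`;
  therefore `n = -n`.
* If an additive function `F` on the scalars kills all eigenvalues of `ad x`, then it kills all
  eigenvalues of `x` on every finite-dimensional module
  (`LieModule.map_eq_zero_of_hasEigenvalue_toEnd`), because traces of elements of `𝔤` vanish on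
  every subrepresentation. Taking `F` to be the real part, the imaginary part and the identity
  gives the statements for elliptic, hyperbolic and nilpotent elements.
-/

/-! ### Conjugation by the exponential of a nilpotent element -/

section Exp

open IsNilpotent in
/-- The unit is `u = exp a`, and the second property is `u * x * u⁻¹ = exp (ad a) x` for an `x`
killed by `(ad a) ^ 3`, multiplied by `2` so that the statement mentions no rational scalars. -/
theorem IsNilpotent.exists_unit_two_mul_mul_eq {A : Type*} [Ring A] [Algebra ℚ A] {a : A}
    (ha : IsNilpotent a) :
    ∃ u : Aˣ, (∀ z, Commute a z → Commute (u : A) z) ∧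
      ∀ x y w : A, a * x - x * a = y → a * y - y * a = w → a * w - w * a = 0 →
        2 * (u * x) = (2 * x + 2 * y + w) * u := by
  obtain ⟨u, hu⟩ := isUnit_exp ha
  obtain ⟨k, hk⟩ := ha
  refine ⟨u, fun z hz ↦ ?_, fun x y w hxy hyw hw ↦ ?_⟩
  · rw [hu, exp_eq_sum hk]
    exact Finset.sum_induction _ (Commute · z) (fun _ _ ↦ .add_left) (.zero_left z)
      fun i _ ↦ (hz.pow_left i).smul_left _
  · -- `ad a = l - r` with `l` and `r` commuting, so that `exp l = exp r * exp (ad a)`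
    set l := LinearMap.mulLeft ℚ a
    set r := LinearMap.mulRight ℚ a
    have hl : l ^ k = 0 := by rw [LinearMap.pow_mulLeft, hk]; simp
    have hr : r ^ k = 0 := by rw [LinearMap.pow_mulRight, hk]; simp
    have hlr : Commute l r := LinearMap.commute_mulLeft_right a a
    have hn : IsNilpotent (l - r) := hlr.isNilpotent_sub ⟨k, hl⟩ ⟨k, hr⟩
    have hl' (v : A) : exp l v = exp a * v := by
      rw [exp_eq_sum hl, exp_eq_sum hk, Finset.sum_mul]
      simp [l, LinearMap.pow_mulLeft]
    have hr' (v : A) : exp r v = v * exp a := by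
      rw [exp_eq_sum hr, exp_eq_sum hk, Finset.mul_sum]
      simp [r, LinearMap.pow_mulRight]
    have h1 : (l - r) x = y := hxy
    have h2 : (l - r) y = w := hyw
    have h3 : (l - r) w = 0 := hw
    have had : exp (l - r) • x = x + y + (2 : ℚ)⁻¹ • w := by
      rw [exp_smul_eq_sum (k := 3) _ hn]
      · simp [Finset.sum_range_succ, pow_two, h1, h2, -LinearMap.sub_apply]
      · simp [pow_succ', h1, h2, h3, -LinearMap.sub_apply]
    have hmul : exp l = exp r * exp (l - r) := by
      rw [← exp_add_of_commute (hlr.symm.sub_right (.refl r)) ⟨k, hr⟩ hn, add_sub_cancel]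
    have key := hl' x
    rw [hmul, Module.End.mul_apply, hr', ← Module.End.smul_def, had] at key
    rw [hu, ← key, ← mul_assoc, mul_add, mul_add]
    congr 2
    rw [two_mul, ← add_smul]
    norm_num

end Exp

/-! ### The semisimple element of an `sl₂`-triple -/

section Sl2

variable {K M : Type*} [Field K] [CharZero K] [AddCommGroup M] [Module K M]
  [FiniteDimensional K M]

open Module.End in
/-- A direct proof, independent of complete reducibility: `exp e * exp (-f) * exp e` conjugates `h`
to `-h` and commutes with the nilpotent part `n` of `h`, so `n` is also the nilpotent part of `-h`,
that is, `n = -n`. -/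
theorem IsSl2Triple.isSemisimple_of_isNilpotent {h e f : Module.End K M}
    (t : IsSl2Triple h e f) (he : IsNilpotent e) (hf : IsNilpotent f) : h.IsSemisimple := by
  let _ : Algebra ℚ (Module.End K M) := Algebra.compHom _ (algebraMap ℚ K)
  obtain ⟨n, hn, s, hs, hnn, hss, hns⟩ := h.exists_isNilpotent_isSemisimple
  have hc : Commute n s := Algebra.commute_of_mem_adjoin_singleton_of_commute hs
      (Algebra.commute_of_mem_adjoin_self hn).symm
  have hef := t.lie_e_f
  have hhe := t.lie_h_e_nsmul
  have hhf := t.lie_h_f_nsmul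
  -- an eigenvector of `ad h` is killed by the nilpotent endomorphism `ad n ∈ K[ad h]`
  have key (x : Module.End K M) (c : K) (hx : ⁅h, x⁆ = c • x) : Commute x n := by
    have h1 : LieAlgebra.ad K _ n ∈ Algebra.adjoin K {LieAlgebra.ad K _ h} := by
      rw [hns]; exact LieAlgebra.ad_mem_adjoin_of_isNilpotent hc hnn hss
    have h2 := LieAlgebra.ad_nilpotent_of_nilpotent (R := K) hnn
    obtain ⟨p, hp⟩ := Algebra.adjoin_mem_exists_aeval K _ h1
    have h3 : LieAlgebra.ad K _ n x = p.eval c • x := by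
      rw [← hp]; exact aeval_apply_of_mem_apply_eq_smul hx
    by_cases hx0 : x = 0
    · simp [hx0]
    have h4 : p.eval c = 0 := by
      obtain ⟨k, hk⟩ := h2
      have : (LieAlgebra.ad K _ n ^ k) x = (p.eval c) ^ k • x :=
        HasEigenvector.pow_apply ⟨mem_eigenspace_iff.mpr h3, hx0⟩ k
      rw [hk] at this
      exact eq_zero_of_pow_eq_zero (by
        simpa only [LinearMap.zero_apply, eq_comm (a := (0 : Module.End K M)),
          smul_eq_zero, hx0, or_false] using this)
    rw [h4, zero_smul, LieAlgebra.ad_apply, Ring.lie_def, sub_eq_zero] at h3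
    exact h3.symm
  have hne : Commute e n := key e 2 (by simp [hhe, two_smul])
  have hnf : Commute f n := key f (-2) (by simp [hhf, two_smul])
  obtain ⟨u, hu, hu'⟩ := he.exists_unit_two_mul_mul_eq
  obtain ⟨v, hv, hv'⟩ := hf.neg.exists_unit_two_mul_mul_eq
  simp only [Ring.lie_def] at hef hhe hhf
  have h2 {a b : Module.End K M} (hab : 2 * a = 2 * b) : a = b := by
    rw [two_mul, two_mul, ← two_smul K, ← two_smul K] at hab
    exact smul_right_injective _ two_ne_zero hab
  have uh : (u : Module.End K M) * h = (h - 2 * e) * u := by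
    refine h2 ((hu' h (-(2 * e)) 0 ?_ ?_ ?_).trans ?_)
    · rw [← neg_sub, hhe]; noncomm_ring
    · noncomm_ring
    · simp
    · noncomm_ring
  have ue : (u : Module.End K M) * e = e * u := hu e (.refl e)
  have vh : (v : Module.End K M) * h = (h - 2 * f) * v := by
    refine h2 ((hv' h (-(2 * f)) 0 ?_ ?_ ?_).trans ?_)
    · rw [two_mul, ← two_nsmul, ← hhf]; noncomm_ring
    · noncomm_ring
    · simp
    · noncomm_ring
  have ve : (v : Module.End K M) * e = (e + h - f) * v := by
    refine h2 ((hv' e h (-(2 * f)) ?_ ?_ ?_).trans ?_)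
    · rw [← hef]; noncomm_ring
    · rw [two_mul, ← two_nsmul, ← hhf]; noncomm_ring
    · noncomm_ring
    · noncomm_ring
  -- conjugation by `g` realizes the Weyl reflection of the triple
  set g := u * v * u with hg
  have gh : (g : Module.End K M) * h = -h * g := by
    rw [hg]
    push_cast
    calc (u * v * u * h : Module.End K M) = u * (v * (u * h)) := by noncomm_ring
      _ = u * ((v * h) - 2 * (v * e)) * u := by rw [uh]; noncomm_ring
      _ = (-(u * h) - 2 * (u * e)) * v * u := by rw [vh, ve]; noncomm_ring
      _ = _ := by rw [uh, ue]; noncomm_ring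
  have gn : Commute (g : Module.End K M) n := by
    rw [hg]
    push_cast
    exact ((hu n hne).mul_left (hv n hnf.neg_left)).mul_left (hu n hne)
  have gs : (g : Module.End K M) * s = (-h - n) * g := by
    rw [eq_sub_of_add_eq' hns.symm, mul_sub, gh, gn.eq, sub_mul]
  have hss' : (-h - n).IsSemisimple :=
    (LinearEquiv.isSemisimple_iff s _ (LinearMap.GeneralLinearGroup.generalLinearEquiv K M g)
      gs).mp hss
  -- both `h = n + s` and `-h = n + (-h - n)` are Jordan-Chevalley decompositions
  have hnh : Commute n h := hns ▸ (Commute.refl n).add_right hc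
  have hn0 : n = -n := (isNilpotent_isSemisimple_unique hnn hss hnn.neg
    (isSemisimple_neg.mpr hss') hc ((hnh.neg_right.sub_right (.refl n)).neg_left.neg_right)
    (by rw [← hns]; abel)).1
  have : (2 : K) • n = 0 := by rw [two_smul, ← sub_neg_eq_add, ← hn0, sub_self]
  replace this : n = 0 := by simpa using this
  rw [hns, this, zero_add]
  exact hss

end Sl2

/-! ### Semisimplicity of `ad s` passes to every representation -/

section Cartan

variable {K L : Type*} [Field K] [LieRing L] [LieAlgebra K L] [FiniteDimensional K L]

/-- A Cartan subalgebra of the centralizer of `s` contains `s`, and it is a Cartan subalgebra of the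
whole algebra because the kernels of `ad s` and of `(ad s) ^ 2` agree. -/
theorem LieAlgebra.exists_isCartanSubalgebra_mem_of_isSemisimple_ad [Infinite K] {s : L}
    (hs : (LieAlgebra.ad K L s).IsSemisimple) :
    ∃ H : LieSubalgebra K L, H.IsCartanSubalgebra ∧ s ∈ H := by
  -- the centralizer of `s`
  let C : LieSubalgebra K L :=
    { LinearMap.ker (LieAlgebra.ad K L s) with
      lie_mem' := fun {x y} hx hy ↦ by
        simp only [AddSubsemigroup.mem_carrier, AddSubmonoid.mem_toSubsemigroup,
          Submodule.mem_toAddSubmonoid, LinearMap.mem_ker, LieAlgebra.ad_apply] at hx hy ⊢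
        rw [leibniz_lie, hx, hy]; simp }
  have memC {x : L} : x ∈ C ↔ ⁅s, x⁆ = 0 := Iff.rfl
  obtain ⟨x, hx⟩ := LieAlgebra.exists_isCartanSubalgebra_engel K C
  set H₀ := LieSubalgebra.engel K x
  let s' : C := ⟨s, memC.mpr (lie_self s)⟩
  have hs' : s' ∈ H₀ := by
    rw [← hx.self_normalizing, LieSubalgebra.mem_normalizer_iff]
    intro y _
    have : ⁅s', y⁆ = 0 := Subtype.ext (memC.mp y.2)
    rw [this]
    exact zero_mem _
  refine ⟨(C.incl.comp H₀.incl).range, ⟨?_, ?_⟩, ?_⟩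
  · have := hx.nilpotent
    exact (LieEquiv.ofInjective (C.incl.comp H₀.incl)
      (Subtype.val_injective.comp Subtype.val_injective)).nilpotent_iff_equiv_nilpotent.mp this
  · refine le_antisymm (fun y hy ↦ ?_) (LieSubalgebra.le_normalizer _)
    rw [LieSubalgebra.mem_normalizer_iff'] at hy
    have h1 : ⁅s, ⁅s, y⁆⁆ = 0 := by
      obtain ⟨z, hz⟩ := hy s ⟨⟨s', hs'⟩, rfl⟩
      rw [← hz]
      exact memC.mp z.1.2
    have h2 : y ∈ C := by
      have : y ∈ (LieAlgebra.ad K L s).maxGenEigenspace 0 :=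
        (Module.End.mem_maxGenEigenspace _ _ _).mpr ⟨2, by simpa [pow_two] using h1⟩
      rw [hs.isFinitelySemisimple.maxGenEigenspace_eq_eigenspace] at this
      simpa [memC] using this
    refine ⟨⟨⟨y, h2⟩, ?_⟩, rfl⟩
    rw [← hx.self_normalizing, LieSubalgebra.mem_normalizer_iff']
    intro z hz
    obtain ⟨w, hw⟩ := hy z ⟨⟨z, hz⟩, rfl⟩
    have : ⁅z, (⟨y, h2⟩ : C)⁆ = w := Subtype.ext hw.symm
    rw [this]
    exact w.2
  · exact ⟨⟨s', hs'⟩, rfl⟩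

variable [CharZero K] [IsAlgClosed K] [LieAlgebra.IsKilling K L]
  {M : Type*} [AddCommGroup M] [Module K M] [LieRingModule L M] [LieModule K L M]
  [FiniteDimensional K M]

open LieAlgebra LieModule LieAlgebra.IsKilling in
/-- The element `s` lies in a Cartan subalgebra, which is abelian and spanned by the coroots; each
coroot belongs to an `sl₂`-triple, so it acts semisimply. -/
theorem LieModule.isSemisimple_toEnd_of_isSemisimple_ad {s : L} (hs : (ad K L s).IsSemisimple) :
    (toEnd K L M s).IsSemisimple := by
  obtain ⟨H, hH, hsH⟩ := exists_isCartanSubalgebra_mem_of_isSemisimple_ad hs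
  suffices ∀ x : H, (toEnd K L M x).IsSemisimple from this ⟨s, hsH⟩
  intro x
  have hx : x ∈ (⊤ : Submodule K H) := trivial
  rw [← RootPairing.IsRootSystem.span_coroot_eq_top (P := rootSystem H)] at hx
  induction hx using Submodule.span_induction with
  | mem x hx =>
    obtain ⟨α, rfl⟩ := hx
    have hα : α.1.IsNonZero := LieSubalgebra.isNonZero_coe_root α
    obtain ⟨h, e, f, t, he, hf⟩ := exists_isSl2Triple_of_weight_isNonZero hα
    have hh : h = coroot α.1 := t.h_eq_coroot hα he hf
    rw [rootSystem_coroot_apply, ← hh]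
    -- `IsSl2Triple` asks for a nonzero `h`, while the triple may act trivially on `M`
    by_cases h0 : toEnd K L M h = 0
    · rw [h0]; exact Module.End.isSemisimple_zero
    refine IsSl2Triple.isSemisimple_of_isNilpotent (e := toEnd K L M e) (f := toEnd K L M f)
      ⟨h0, ?_, ?_, ?_⟩ (LieModule.isNilpotent_toEnd_of_mem_rootSpace M H hα he)
      (LieModule.isNilpotent_toEnd_of_mem_rootSpace M H (neg_ne_zero.mpr hα) hf)
    · rw [← LieHom.map_lie, t.lie_e_f]
    · rw [← LieHom.map_lie, t.lie_h_e_nsmul, map_nsmul]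
    · rw [← LieHom.map_lie, t.lie_h_f_nsmul, map_neg, map_nsmul]
  | zero => simp
  | add x y _ _ hx hy =>
    have : Commute (toEnd K L M x) (toEnd K L M y) := by
      rw [commute_iff_lie_eq, ← LieHom.map_lie, ← LieSubalgebra.coe_bracket, trivial_lie_zero]
      simp
    simpa using hx.add_of_commute this hy
  | smul c x _ hx => simpa using Module.End.IsSemisimple_smul c hx

end Cartan

/-! ### Additive conditions on eigenvalues pass to every representation -/

section Trace

variable {K : Type*} [Field K]

/-- If an additive map takes the same value `c` on all eigenvalues, it takes the value
`dim W • c` on the trace. -/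
theorem LinearMap.map_trace_eq_finrank_nsmul [IsAlgClosed K] {W A : Type*} [AddCommGroup W]
    [Module K W] [FiniteDimensional K W] [AddCommGroup A] (F : K →+ A) (c : A)
    (T : Module.End K W) (h : ∀ μ, T.HasEigenvalue μ → F μ = c) :
    F (LinearMap.trace K W T) = Module.finrank K W • c := by
  have hsp := IsAlgClosed.splits T.charpoly
  rw [Module.End.trace_eq_sum_roots_charpoly_of_splits hsp, map_multiset_sum,
    Multiset.map_congr (g := fun _ ↦ c) rfl, Multiset.map_const', Multiset.sum_replicate,
    ← hsp.natDegree_eq_card_roots, LinearMap.charpoly_natDegree]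
  intro μ hμ
  exact h μ (Module.End.hasEigenvalue_iff_isRoot_charpoly _ _ |>.mpr
    (Polynomial.isRoot_of_mem_roots hμ))

variable {L : Type*} [LieRing L] [LieAlgebra K L] [FiniteDimensional K L]

open LieAlgebra in
/-- A dual form of `⁅L, L⁆ = L`: the functional is represented by an element `t` through the Killing
form, and invariance forces `t` to be central. -/
theorem LieAlgebra.IsKilling.linearMap_eq_zero_of_lie [IsKilling K L] (τ : L →ₗ[K] K)
    (h : ∀ x y : L, τ ⁅x, y⁆ = 0) : τ = 0 := by
  obtain ⟨t, ht⟩ : ∃ t, killingForm K L t = τ :=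
    ⟨_, LinearMap.ext (LinearMap.BilinForm.apply_toDual_symm_apply
      (hB := IsKilling.killingForm_nondegenerate K L) τ)⟩
  have h0 : t ∈ LieAlgebra.center K L := by
    rw [LieModule.mem_maxTrivSubmodule]
    intro x
    rw [← lie_skew, neg_eq_zero]
    have : ⁅t, x⁆ ∈ LinearMap.ker (killingForm K L) := by
      rw [LinearMap.mem_ker]
      ext y
      rw [LieModule.traceForm_apply_lie_apply, ht, h, LinearMap.zero_apply]
    simpa using this
  rw [center_eq_bot, LieSubmodule.mem_bot] at h0
  rw [← ht, h0, map_zero]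

open LieAlgebra LieModule Module.End in
/-- If an additive map `F` vanishes on the eigenvalues of `ad x`, then it vanishes on the
eigenvalues of `x` in every representation. The generalized eigenspaces of `x` on which `F`
takes a fixed value `c` span a subrepresentation `W`; the trace of `x` on `W` vanishes, while `F` maps it to
`dim W • c`. -/
theorem LieModule.map_eq_zero_of_hasEigenvalue_toEnd [IsAlgClosed K] [CharZero K] [IsKilling K L]
    {M : Type*} [AddCommGroup M] [Module K M] [LieRingModule L M] [LieModule K L M]
    [FiniteDimensional K M] {A : Type*} [AddCommGroup A] [IsAddTorsionFree A] (F : K →+ A) {x : L}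
    (hF : ∀ μ, (ad K L x).HasEigenvalue μ → F μ = 0) {μ : K}
    (hμ : (toEnd K L M x).HasEigenvalue μ) : F μ = 0 := by
  set T := toEnd K L M x
  let W : LieSubmodule K L M :=
    { (⨆ ν ∈ {ν | F ν = F μ}, T.maxGenEigenspace ν : Submodule K M) with
      lie_mem := by
        intro y m hm
        simp only [AddSubsemigroup.mem_carrier, AddSubmonoid.mem_toSubsemigroup,
          Submodule.mem_toAddSubmonoid] at hm ⊢
        have hy : y ∈ ⨆ ρ, (ad K L x).maxGenEigenspace ρ := by simp [iSup_maxGenEigenspace_eq_top]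
        induction hy using Submodule.iSup_induction' with
        | zero => simp
        | add y z _ _ hy hz => rw [add_lie]; exact add_mem hy hz
        | mem ρ y hy =>
          by_cases hy0 : y = 0
          · simp [hy0]
          have hρ : F ρ = 0 := hF ρ <| by
            refine (hasUnifEigenvalue_iff_hasUnifEigenvalue_one ENat.top_pos).mp fun h ↦ hy0 ?_
            rwa [maxGenEigenspace, h, Submodule.mem_bot] at hy
          induction hm using Submodule.iSup_induction' with
          | zero => simp
          | add y z _ _ hy hz => rw [lie_add]; exact add_mem hy hz
          | mem ν m hm =>
            by_cases hν : F ν = F μ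
            · rw [iSup_pos (show ν ∈ {ν | F ν = F μ} from hν)] at hm
              have := lie_mem_maxGenEigenspace_toEnd hy hm
              refine Submodule.mem_iSup_of_mem (ρ + ν) (Submodule.mem_iSup_of_mem ?_ this)
              simp [hρ, hν]
            · rw [iSup_neg (show ν ∉ {ν | F ν = F μ} from hν), Submodule.mem_bot] at hm
              simp [hm] }
  have hWT (w : W) : (toEnd K L W x w : M) = T w := rfl
  have hW (ν : K) (hν : (toEnd K L W x).HasEigenvalue ν) : F ν = F μ := by
    obtain ⟨w, hw⟩ := hν.exists_hasEigenvector
    by_contra hne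
    have h1 : (w : M) ∈ T.maxGenEigenspace ν := eigenspace_le_maxGenEigenspace <| by
      rw [mem_eigenspace_iff, ← hWT, hw.apply_eq_smul]; rfl
    have h2 := T.independent_maxGenEigenspace.disjoint_biSup (y := {ν | F ν = F μ}) hne
    exact hw.2 (Subtype.ext (Submodule.disjoint_def.mp h2 _ h1 w.2))
  have htr : LinearMap.trace K W (toEnd K L W x) = 0 :=
    LinearMap.congr_fun (IsKilling.linearMap_eq_zero_of_lie
      (LinearMap.trace K W ∘ₗ (toEnd K L W : L →ₗ[K] Module.End K W)) fun y z ↦ by simp) x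
  have key := LinearMap.map_trace_eq_finrank_nsmul F (F μ) _ hW
  rw [htr, map_zero, eq_comm, smul_eq_zero] at key
  refine key.resolve_left fun h0 ↦ ?_
  rw [Module.finrank_zero_iff] at h0
  obtain ⟨m, hm⟩ := hμ.exists_hasEigenvector
  have : m ∈ W := Submodule.mem_iSup_of_mem μ
    (Submodule.mem_iSup_of_mem rfl (eigenspace_le_maxGenEigenspace hm.1))
  exact hm.2 (congrArg Subtype.val (Subsingleton.elim (⟨m, this⟩ : W) 0))

end Trace

/-! ### Extension of scalars of the Killing form -/

section BaseChange

theorem LieAlgebra.IsKilling.baseChange {K : Type*} (A : Type*) [Field K] [Field A] [Algebra K A]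
    (L : Type*) [LieRing L] [LieAlgebra K L] [FiniteDimensional K L] [IsKilling K L] :
    IsKilling A (A ⊗[K] L) := by
  have h := (LinearMap.BilinForm.nondegenerate_iff_det_ne_zero (Module.finBasis K L)).mp
    (killingForm_nondegenerate K L)
  have hB : LinearMap.BilinForm.toMatrix ((Module.finBasis K L).baseChange A)
      (killingForm A (A ⊗[K] L)) =
      (algebraMap K A).mapMatrix (LinearMap.BilinForm.toMatrix (Module.finBasis K L)
        (killingForm K L)) := by
    ext i j
    simp [LieModule.traceForm_baseChange, Algebra.algebraMap_eq_smul_one]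
  have h' : (killingForm A (A ⊗[K] L)).Nondegenerate := by
    rw [LinearMap.BilinForm.nondegenerate_iff_det_ne_zero ((Module.finBasis K L).baseChange A),
      hB, ← RingHom.map_det]
    simpa using h
  constructor
  rw [← LieSubmodule.toSubmodule_inj, LieIdeal.toSubmodule_killingCompl,
    LieSubmodule.top_toSubmodule,
    LinearMap.BilinForm.orthogonal_top_eq_ker (LieModule.traceForm_isSymm ..).isRefl,
    LinearMap.BilinForm.nondegenerate_iff_ker_eq_bot.mp h', LieSubmodule.bot_toSubmodule]

end BaseChange

/-! ### Diagonalizable complex endomorphisms -/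

section Diag

open Module.End

variable {W : Type*} [AddCommGroup W] [Module ℂ W]

/-- If `S` is diagonalizable and `T` acts as the scalar `F μ` on the `μ`-eigenspace of `S`, then `T`
is diagonalizable and its eigenvalues are values of `F`. -/
theorem Module.End.iSup_eigenspace_eq_top_of_forall_apply_eq {S T : Module.End ℂ W} {F : ℂ → ℂ}
    (hS : ⨆ μ : ℂ, S.eigenspace μ = ⊤) (h : ∀ μ v, S v = μ • v → T v = F μ • v) :
    (⨆ μ : ℂ, T.eigenspace μ = ⊤) ∧ ∀ ν, T.HasEigenvalue ν → ∃ μ, F μ = ν := by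
  have hle (μ : ℂ) : S.eigenspace μ ≤ T.eigenspace (F μ) := fun v hv ↦
    mem_eigenspace_iff.mpr (h μ v (mem_eigenspace_iff.mp hv))
  refine ⟨eq_top_iff.mpr (hS ▸ iSup_le fun μ ↦ (hle μ).trans (le_iSup T.eigenspace (F μ))),
    fun ν hν ↦ ?_⟩
  by_contra! hne
  refine hν ?_
  have hd := T.eigenspaces_iSupIndep ν
  rw [disjoint_iff, eq_top_iff (a := ⨆ ρ ≠ ν, _) |>.mpr (hS ▸ iSup_le fun μ ↦
    (hle μ).trans (le_iSup₂_of_le (F μ) (hne μ) le_rfl)), inf_top_eq] at hd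
  exact hd

variable [FiniteDimensional ℂ W]

/-- The semisimple part of `T` agrees with `T` on eigenvectors. -/
theorem Module.End.isSemisimple_of_iSup_eigenspace_eq_top {T : Module.End ℂ W}
    (h : ⨆ μ : ℂ, T.eigenspace μ = ⊤) : T.IsSemisimple := by
  obtain ⟨n, hn, s, hs, hnn, hss, hns⟩ := T.exists_isNilpotent_isSemisimple
  have hTs : Commute T s := Algebra.commute_of_mem_adjoin_self hs
  suffices T = s by rwa [this]
  rw [← sub_eq_zero, ← LinearMap.ker_eq_top, eq_top_iff, ← h, iSup_le_iff]
  intro μ v hv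
  have : s v = μ • v := apply_eq_of_mem_of_comm_of_isFinitelySemisimple_of_isNil
    (eigenspace_le_maxGenEigenspace hv) hTs hss.isFinitelySemisimple
    (by rwa [hns, add_sub_cancel_right])
  rw [LinearMap.mem_ker, LinearMap.sub_apply, this, mem_eigenspace_iff.mp hv, sub_self]

theorem Module.End.hasEigenvalue_sub_of_commute {S T : Module.End ℂ W} (hST : Commute S T) {ν : ℂ}
    (h : (S - T).HasEigenvalue ν) :
    ∃ μ, S.HasEigenvalue μ ∧ T.HasEigenvalue (μ - ν) := by
  have hS : Set.MapsTo S ((S - T).eigenspace ν) ((S - T).eigenspace ν) :=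
    mapsTo_genEigenspace_of_comm ((Commute.refl S).sub_left hST.symm) ν 1
  have : Nontrivial ((S - T).eigenspace ν) := Submodule.nontrivial_iff_ne_bot.mpr h
  obtain ⟨μ, hμ⟩ := exists_eigenvalue (S.restrict hS)
  obtain ⟨v, hv⟩ := hμ.exists_hasEigenvector
  have h0 : (v : W) ≠ 0 := by simpa using hv.2
  have h1 : S v = μ • (v : W) := congrArg Subtype.val hv.apply_eq_smul
  have h2 : S v - T v = ν • (v : W) := mem_eigenspace_iff.mp v.2
  refine ⟨μ, hasEigenvalue_of_hasEigenvector ⟨mem_eigenspace_iff.mpr h1, h0⟩,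
    hasEigenvalue_of_hasEigenvector ⟨mem_eigenspace_iff.mpr ?_, h0⟩⟩
  rw [sub_smul, ← h1, ← h2, sub_sub_cancel]

/-- Uniqueness against a reference decomposition `E' + H' + N'` such that `E'` and `H'` commute with
everything that commutes with the sum. The nilpotent parts agree by uniqueness of the
Jordan-Chevalley decomposition, and `E - E' = H' - H` is semisimple with eigenvalues both
imaginary and real. -/
theorem Module.End.eq_of_elliptic_add_hyperbolic_add_nilpotent {E H N E' H' N' : Module.End ℂ W}
    (hsum : E + H + N = E' + H' + N')
    (hEH : Commute E H) (hEN : Commute E N) (hHN : Commute H N)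
    (hEH' : Commute E' H') (hEN' : Commute E' N') (hHN' : Commute H' N')
    (hcomm : ∀ T, Commute T (E + H + N) → Commute T E' ∧ Commute T H')
    (hE : E.IsSemisimple) (hH : H.IsSemisimple) (hE' : E'.IsSemisimple) (hH' : H'.IsSemisimple)
    (hN : IsNilpotent N) (hN' : IsNilpotent N')
    (im : ∀ μ, E.HasEigenvalue μ → μ.re = 0) (im' : ∀ μ, E'.HasEigenvalue μ → μ.re = 0)
    (re : ∀ μ, H.HasEigenvalue μ → μ.im = 0) (re' : ∀ μ, H'.HasEigenvalue μ → μ.im = 0) :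
    E = E' ∧ H = H' ∧ N = N' := by
  obtain ⟨h1, h2⟩ := isNilpotent_isSemisimple_unique hN (hE.add_of_commute hEH hH) hN'
    (hE'.add_of_commute hEH' hH') (hEN.symm.add_right hHN.symm) (hEN'.symm.add_right hHN'.symm)
    (by rw [add_comm, hsum, add_comm])
  have cE := hcomm E (((Commute.refl E).add_right hEH).add_right hEN)
  have cH := hcomm H ((hEH.symm.add_right (.refl H)).add_right hHN)
  have h3 : E - E' = H' - H := by rw [sub_eq_sub_iff_add_eq_add, h2, add_comm]
  have h4 : E - E' = 0 := by
    refine (hE.sub_of_commute cE.1 hE').eq_zero_iff_forall_eigenvalue.mpr fun ν hν ↦ ?_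
    obtain ⟨μ, hμ, hμ'⟩ := hasEigenvalue_sub_of_commute cE.1 hν
    rw [h3] at hν
    obtain ⟨ρ, hρ, hρ'⟩ := hasEigenvalue_sub_of_commute cH.2.symm hν
    have a1 := im _ hμ
    have a2 := im' _ hμ'
    have a3 := re' _ hρ
    have a4 := re _ hρ'
    rw [Complex.sub_re] at a2
    rw [Complex.sub_im] at a4
    apply Complex.ext <;> simp only [Complex.zero_re, Complex.zero_im] <;> linarith
  refine ⟨sub_eq_zero.mp h4, (sub_eq_zero.mp (h3.symm.trans h4)).symm, h1⟩

end Diag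

/-! ### The linear Jordan decomposition over the reals -/

section Real

open Module.End Polynomial

variable {V : Type*} [AddCommGroup V] [Module ℝ V]

theorem complexify_eq_baseChangeHom (T : Module.End ℝ V) :
    complexify T = Module.End.baseChangeHom ℝ ℂ V T := rfl

theorem complexify_injective : Function.Injective (complexify (V := V)) :=
  LinearMap.baseChangeHom_injective ℝ V ℂ

@[simp] theorem complexify_add (S T : Module.End ℝ V) :
    complexify (S + T) = complexify S + complexify T :=
  LinearMap.baseChange_add ..

@[simp] theorem complexify_sub (S T : Module.End ℝ V) :
    complexify (S - T) = complexify S - complexify T :=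
  LinearMap.baseChange_sub ..

theorem Commute.complexify {S T : Module.End ℝ V} (h : Commute S T) :
    Commute (complexify S) (complexify T) :=
  h.map (Module.End.baseChangeHom ℝ ℂ V)

theorem IsNilpotent.complexify {T : Module.End ℝ V} (h : IsNilpotent T) :
    IsNilpotent (complexify T) :=
  h.map (Module.End.baseChangeHom ℝ ℂ V)

theorem complexify_aeval (T : Module.End ℝ V) (p : ℝ[X]) :
    complexify (aeval T p) = aeval (complexify T) (p.map (algebraMap ℝ ℂ)) := by
  rw [aeval_map_algebraMap, complexify_eq_baseChangeHom, complexify_eq_baseChangeHom]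
  exact (aeval_algHom_apply ((Module.End.baseChangeHom ℝ ℂ V)) T p).symm

/-- The function `re` on a finite set of complex numbers is interpolated by a polynomial with real
coefficients. -/
theorem Complex.exists_real_polynomial_eval_eq_re (s : Finset ℂ) :
    ∃ q : ℝ[X], ∀ μ ∈ s, (q.map (algebraMap ℝ ℂ)).eval μ = (μ.re : ℂ) := by
  classical
  -- interpolate on a set stable under conjugation, then average with the conjugate polynomial
  let t := s ∪ s.image (starRingEnd ℂ)
  let p : ℂ[X] := Lagrange.interpolate t id fun μ ↦ (μ.re : ℂ)
  have hp (μ : ℂ) (hμ : μ ∈ t) : p.eval μ = (μ.re : ℂ) :=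
    Lagrange.eval_interpolate_at_node _ (Set.injOn_id _) hμ
  let q : ℝ[X] := ∑ i ∈ p.support, monomial i (p.coeff i).re
  have hq : q.map (algebraMap ℝ ℂ) = C 2⁻¹ * (p + p.map (starRingEnd ℂ)) := by
    ext i
    have : q.coeff i = (p.coeff i).re := by
      simp only [q, finsetSum_coeff, coeff_monomial, Finset.sum_ite_eq', mem_support_iff]
      split_ifs with h
      · rfl
      · simp [not_not.mp h]
    rw [coeff_map, this, coeff_C_mul, coeff_add, coeff_map, Complex.add_conj]
    simp
  refine ⟨q, fun μ hμ ↦ ?_⟩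
  have h1 : p.eval μ = (μ.re : ℂ) := hp μ (Finset.mem_union_left _ hμ)
  have h2 : (p.map (starRingEnd ℂ)).eval μ = (μ.re : ℂ) := by
    have := hp _ (Finset.mem_union_right _ (Finset.mem_image_of_mem (starRingEnd ℂ) hμ))
    have h3 := congrArg (starRingEnd ℂ) this
    rw [← Polynomial.eval_map_apply] at h3
    simpa using h3
  rw [hq, eval_mul, eval_C, eval_add, h1, h2]
  ring

variable [FiniteDimensional ℝ V]

theorem Module.End.IsSemisimple.complexify {T : Module.End ℝ V} (hT : T.IsSemisimple) :
    (complexify T).IsSemisimple := by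
  refine isSemisimple_of_squarefree_aeval_eq_zero
    (p := (minpoly ℝ T).map (algebraMap ℝ ℂ)) ?_ ?_
  · exact ((PerfectField.separable_iff_squarefree.mpr hT.minpoly_squarefree).map).squarefree
  · rw [← complexify_aeval, minpoly.aeval]
    exact LinearMap.baseChange_zero

/-- With `S` the semisimple part of `X`, the hyperbolic part is `q(S)` for a real polynomial `q`
that interpolates `re` on the eigenvalues of `S`. All parts are polynomials in `X`, and on the
generalized `μ`-eigenspace of `X` the elliptic and hyperbolic parts are the scalars `i im μ` and
`re μ`. -/
theorem exists_isLinearJordanDecomposition (X : Module.End ℝ V) :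
    ∃ E H N : Module.End ℝ V, IsLinearJordanDecomposition X E H N ∧
      E ∈ Algebra.adjoin ℝ {X} ∧ H ∈ Algebra.adjoin ℝ {X} ∧
      ∀ (μ : ℂ) (v : ℂ ⊗[ℝ] V), v ∈ (complexify X).maxGenEigenspace μ →
        complexify E v = ((μ.im : ℂ) * Complex.I) • v ∧ complexify H v = (μ.re : ℂ) • v := by
  obtain ⟨N, hN, S, hS, hNn, hSs, hX⟩ := X.exists_isNilpotent_isSemisimple
  have hSc := hSs.complexify
  have hXS : Commute X S := Algebra.commute_of_mem_adjoin_self hS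
  have hNS : Commute N S := Algebra.commute_of_mem_adjoin_singleton_of_commute hS
      (Algebra.commute_of_mem_adjoin_self hN).symm
  have hfin : {μ | (complexify S).HasEigenvalue μ}.Finite := finite_hasEigenvalue _
  obtain ⟨q, hq⟩ := Complex.exists_real_polynomial_eval_eq_re hfin.toFinset
  have hH (μ : ℂ) (v : ℂ ⊗[ℝ] V) (hv : complexify S v = μ • v) :
      complexify (aeval S q) v = (μ.re : ℂ) • v := by
    by_cases h0 : v = 0
    · simp [h0]
    rw [complexify_aeval, aeval_apply_of_mem_apply_eq_smul hv, hq]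
    simpa using hasEigenvalue_of_hasEigenvector ⟨mem_eigenspace_iff.mpr hv, h0⟩
  have hE (μ : ℂ) (v : ℂ ⊗[ℝ] V) (hv : complexify S v = μ • v) :
      complexify (S - aeval S q) v = ((μ.im : ℂ) * Complex.I) • v := by
    rw [complexify_sub, LinearMap.sub_apply, hv, hH μ v hv, ← sub_smul]
    congr 1
    rw [sub_eq_iff_eq_add', Complex.re_add_im]
  have hSH : Commute S (aeval S q) :=
    Algebra.commute_of_mem_adjoin_self (aeval_mem_adjoin_singleton ℝ S)
  have hNH : Commute N (aeval S q) :=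
    Algebra.commute_of_mem_adjoin_singleton_of_commute (aeval_mem_adjoin_singleton ℝ S) hNS
  have hqS : aeval S q ∈ Algebra.adjoin ℝ {X} :=
    Algebra.adjoin_le (Set.singleton_subset_iff.mpr hS) (aeval_mem_adjoin_singleton ℝ S)
  obtain ⟨e1, e2⟩ := iSup_eigenspace_eq_top_of_forall_apply_eq hSc.iSup_eigenspace_eq_top hE
  obtain ⟨h1, h2⟩ := iSup_eigenspace_eq_top_of_forall_apply_eq hSc.iSup_eigenspace_eq_top hH
  refine ⟨S - aeval S q, aeval S q, N, ⟨?_, hSH.sub_left (.refl _), (hNS.sub_right hNH).symm,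
    hNH.symm, ⟨e1, fun μ hμ ↦ ?_⟩, ⟨h1, fun μ hμ ↦ ?_⟩, hNn⟩, sub_mem hS hqS, hqS,
    fun μ v hv ↦ ?_⟩
  · rw [sub_add_cancel, add_comm, hX]
  · obtain ⟨ν, rfl⟩ := e2 μ hμ
    simp
  · obtain ⟨ν, rfl⟩ := h2 μ hμ
    simp
  · have : complexify S v = μ • v := apply_eq_of_mem_of_comm_of_isFinitelySemisimple_of_isNil hv
      hXS.complexify hSc.isFinitelySemisimple (by
        rw [← complexify_sub, hX, add_sub_cancel_right]; exact hNn.complexify)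
    exact ⟨hE μ v this, hH μ v this⟩

theorem IsLinearJordanDecomposition.unique {X E H N E' H' N' : Module.End ℝ V}
    (h : IsLinearJordanDecomposition X E H N) (h' : IsLinearJordanDecomposition X E' H' N') :
    E = E' ∧ H = H' ∧ N = N' := by
  obtain ⟨E₀, H₀, N₀, h₀, hE₀, hH₀, -⟩ := exists_isLinearJordanDecomposition X
  suffices ∀ {E H N}, IsLinearJordanDecomposition X E H N → E = E₀ ∧ H = H₀ ∧ N = N₀ by
    grind
  intro E H N h
  have key := eq_of_elliptic_add_hyperbolic_add_nilpotent (W := ℂ ⊗[ℝ] V)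
    (by simp only [← complexify_add, ← h.sum_eq, ← h₀.sum_eq])
    h.commute_EH.complexify h.commute_EN.complexify h.commute_HN.complexify
    h₀.commute_EH.complexify h₀.commute_EN.complexify h₀.commute_HN.complexify ?_
    (isSemisimple_of_iSup_eigenspace_eq_top h.elliptic.1)
    (isSemisimple_of_iSup_eigenspace_eq_top h.hyperbolic.1)
    (isSemisimple_of_iSup_eigenspace_eq_top h₀.elliptic.1)
    (isSemisimple_of_iSup_eigenspace_eq_top h₀.hyperbolic.1)
    h.nilpotent.complexify h₀.nilpotent.complexify h.elliptic.2 h₀.elliptic.2 h.hyperbolic.2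
    h₀.hyperbolic.2
  · exact ⟨complexify_injective key.1, complexify_injective key.2.1, complexify_injective key.2.2⟩
  · intro T hT
    rw [← complexify_add, ← complexify_add, ← h.sum_eq] at hT
    have aux {Y : Module.End ℝ V} (hY : Y ∈ Algebra.adjoin ℝ {X}) : Commute T (complexify Y) := by
      obtain ⟨p, rfl⟩ := Algebra.adjoin_mem_exists_aeval ℝ _ hY
      rw [complexify_aeval]
      exact Algebra.commute_of_mem_adjoin_singleton_of_commute
        (aeval_mem_adjoin_singleton ℂ (complexify X)) hT
    exact ⟨aux hE₀, aux hH₀⟩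

end Real

/-! ### The abstract Jordan decomposition -/

section Abstract

open LieAlgebra Module.End

/-- An endomorphism acting as the scalar `F μ` on the generalized `μ`-eigenspaces of `ad x`, with
`F` additive, is a derivation, because these eigenspaces grade the Lie algebra. -/
theorem LieAlgebra.apply_lie_of_forall_maxGenEigenspace_ad {K L : Type*} [Field K]
    [IsAlgClosed K] [LieRing L] [LieAlgebra K L] [FiniteDimensional K L] (x : L) (F : K →+ K)
    (D : Module.End K L) (hD : ∀ μ, ∀ v ∈ (ad K L x).maxGenEigenspace μ, D v = F μ • v) (u v : L) :
    D ⁅u, v⁆ = ⁅D u, v⁆ + ⁅u, D v⁆ := by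
  have hu : u ∈ ⨆ μ, (ad K L x).maxGenEigenspace μ := by simp [iSup_maxGenEigenspace_eq_top]
  have hv : v ∈ ⨆ μ, (ad K L x).maxGenEigenspace μ := by simp [iSup_maxGenEigenspace_eq_top]
  induction hu using Submodule.iSup_induction' with
  | zero => simp
  | add u u' _ _ hu hu' => simp only [add_lie, map_add, hu, hu']; abel
  | mem μ u hu =>
    induction hv using Submodule.iSup_induction' with
    | zero => simp
    | add v v' _ _ hv hv' => simp only [lie_add, map_add, hv, hv']; abel
    | mem ν v hv =>
      rw [hD μ u hu, hD ν v hv, hD (μ + ν) _ (LieModule.lie_mem_maxGenEigenspace_toEnd hu hv),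
        map_add, add_smul, smul_lie, lie_smul]

theorem Module.End.isNilpotent_of_forall_hasEigenvalue_eq_zero {K W : Type*} [Field K]
    [IsAlgClosed K] [AddCommGroup W] [Module K W] [FiniteDimensional K W] {T : Module.End K W}
    (h : ∀ μ, T.HasEigenvalue μ → μ = 0) : IsNilpotent T := by
  have h0 : T.maxGenEigenspace 0 = ⊤ := by
    rw [eq_top_iff, ← iSup_maxGenEigenspace_eq_top T, iSup_le_iff]
    intro μ
    by_cases hμ : T.maxGenEigenspace μ = ⊥
    · simp [hμ]
    · rw [h μ ((hasUnifEigenvalue_iff_hasUnifEigenvalue_one ENat.top_pos).mp hμ)]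
  refine isNilpotent_iff_of_finite.mpr fun v ↦ ?_
  have hv : v ∈ T.maxGenEigenspace 0 := h0 ▸ Submodule.mem_top
  simpa [mem_maxGenEigenspace] using hv

variable {𝔤 : Type*} [LieRing 𝔤] [LieAlgebra ℝ 𝔤]

theorem complexify_toEnd {M : Type*} [AddCommGroup M] [Module ℝ M] [LieRingModule 𝔤 M]
    [LieModule ℝ 𝔤 M] (x : 𝔤) :
    complexify (LieModule.toEnd ℝ 𝔤 M x) =
      LieModule.toEnd ℂ (ℂ ⊗[ℝ] 𝔤) (ℂ ⊗[ℝ] M) (1 ⊗ₜ x) :=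
  (LieModule.toEnd_baseChange ..).symm

theorem complexify_ad (x : 𝔤) : complexify (ad ℝ 𝔤 x) = ad ℂ (ℂ ⊗[ℝ] 𝔤) (1 ⊗ₜ x) :=
  complexify_toEnd x

/-- The real form of `LieAlgebra.apply_lie_of_forall_maxGenEigenspace_ad`, with the Leibniz rule in
the shape that `LieDerivation` requires. -/
theorem apply_lie_of_forall_maxGenEigenspace_complexify_ad [FiniteDimensional ℝ 𝔤] (x : 𝔤)
    (F : ℂ →+ ℂ) (D : Module.End ℝ 𝔤)
    (hD : ∀ μ, ∀ v ∈ (complexify (ad ℝ 𝔤 x)).maxGenEigenspace μ, complexify D v = F μ • v)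
    (a b : 𝔤) : D ⁅a, b⁆ = ⁅a, D b⁆ - ⁅b, D a⁆ := by
  rw [complexify_ad] at hD
  have h1 := apply_lie_of_forall_maxGenEigenspace_ad _ F (complexify D) hD (1 ⊗ₜ a) (1 ⊗ₜ b)
  have hT (c : 𝔤) : complexify D (1 ⊗ₜ c) = 1 ⊗ₜ D c := LinearMap.baseChange_tmul ..
  have hb (c d : 𝔤) : ⁅(1 : ℂ) ⊗ₜ[ℝ] c, (1 : ℂ) ⊗ₜ[ℝ] d⁆ = 1 ⊗ₜ ⁅c, d⁆ := by
    rw [ExtendScalars.bracket_tmul, mul_one]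
  have h2 : (1 : ℂ) ⊗ₜ[ℝ] D ⁅a, b⁆ = 1 ⊗ₜ (⁅D a, b⁆ + ⁅a, D b⁆) := by
    rw [TensorProduct.tmul_add, ← hb, ← hb, ← hT, ← hT, ← hT, ← hb]
    exact h1
  rw [Module.FaithfullyFlat.tensorProduct_mk_injective 𝔤 h2, ← lie_skew b,
    sub_neg_eq_add, add_comm]

theorem IsAbstractJordanDecomposition.ad {X E H N : 𝔤}
    (h : IsAbstractJordanDecomposition X E H N) :
    IsLinearJordanDecomposition (ad ℝ 𝔤 X) (ad ℝ 𝔤 E) (ad ℝ 𝔤 H) (ad ℝ 𝔤 N) where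
  sum_eq := by rw [h.sum_eq, map_add, map_add]
  commute_EH := by rw [commute_iff_lie_eq, ← LieHom.map_lie, h.commute_EH, map_zero]
  commute_EN := by rw [commute_iff_lie_eq, ← LieHom.map_lie, h.commute_EN, map_zero]
  commute_HN := by rw [commute_iff_lie_eq, ← LieHom.map_lie, h.commute_HN, map_zero]
  elliptic := h.elliptic
  hyperbolic := h.hyperbolic
  nilpotent := h.nilpotent

theorem LieAlgebra.ad_injective_of_hasTrivialRadical [HasTrivialRadical ℝ 𝔤] :
    Function.Injective (ad ℝ 𝔤) :=
  (LieHom.ker_eq_bot _).mp (ad_ker_eq_bot_of_hasTrivialRadical ..)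

variable [FiniteDimensional ℝ 𝔤] [HasTrivialRadical ℝ 𝔤]

theorem LieAlgebra.exists_ad_eq_of_forall_maxGenEigenspace (x : 𝔤) (F : ℂ →+ ℂ)
    (D : Module.End ℝ 𝔤)
    (hD : ∀ μ, ∀ v ∈ (complexify (ad ℝ 𝔤 x)).maxGenEigenspace μ, complexify D v = F μ • v) :
    ∃ d, ad ℝ 𝔤 d = D := by
  obtain ⟨d, hd⟩ := LieDerivation.IsKilling.exists_eq_ad (R := ℝ) (L := 𝔤)
    ⟨D, apply_lie_of_forall_maxGenEigenspace_complexify_ad x F D hD⟩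
  exact ⟨d, by rw [← LieDerivation.coe_ad_apply_eq_ad_apply, hd]⟩

/-- The parts of the linear Jordan decomposition of `ad X` are derivations, hence inner. -/
theorem exists_isAbstractJordanDecomposition (X : 𝔤) :
    ∃ E H N : 𝔤, IsAbstractJordanDecomposition X E H N := by
  obtain ⟨E', H', N', h, -, -, hF⟩ := exists_isLinearJordanDecomposition (ad ℝ 𝔤 X)
  obtain ⟨E, rfl⟩ := exists_ad_eq_of_forall_maxGenEigenspace X
    ((AddMonoidHom.mulRight Complex.I).comp
      ((Complex.ofRealHom : ℝ →+ ℂ).comp Complex.imAddGroupHom))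
    E' fun μ v hv ↦ (hF μ v hv).1
  obtain ⟨H, rfl⟩ := exists_ad_eq_of_forall_maxGenEigenspace X
    ((Complex.ofRealHom : ℝ →+ ℂ).comp Complex.reAddGroupHom) H' fun μ v hv ↦ (hF μ v hv).2
  have hN : N' = ad ℝ 𝔤 (X - E - H) := by
    rw [map_sub, map_sub, h.sum_eq]; abel
  subst hN
  have inj {a b : 𝔤} (hab : Commute (ad ℝ 𝔤 a) (ad ℝ 𝔤 b)) : ⁅a, b⁆ = 0 :=
    ad_injective_of_hasTrivialRadical (by
      rw [LieHom.map_lie, map_zero, ← commute_iff_lie_eq]; exact hab)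
  exact ⟨E, H, X - E - H, by abel, inj h.commute_EH, inj h.commute_EN, inj h.commute_HN,
    h.elliptic, h.hyperbolic, h.nilpotent⟩

theorem IsAbstractJordanDecomposition.unique {X E H N E' H' N' : 𝔤}
    (h : IsAbstractJordanDecomposition X E H N) (h' : IsAbstractJordanDecomposition X E' H' N') :
    E = E' ∧ H = H' ∧ N = N' := by
  obtain ⟨h1, h2, h3⟩ := h.ad.unique h'.ad
  exact ⟨ad_injective_of_hasTrivialRadical h1, ad_injective_of_hasTrivialRadical h2,
    ad_injective_of_hasTrivialRadical h3⟩

variable {M : Type*} [AddCommGroup M] [Module ℝ M] [LieRingModule 𝔤 M] [LieModule ℝ 𝔤 M]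
  [FiniteDimensional ℝ M]

theorem IsSemisimpleMap.toEnd_of_ad {x : 𝔤} (h : IsSemisimpleMap (ad ℝ 𝔤 x)) :
    IsSemisimpleMap (LieModule.toEnd ℝ 𝔤 M x) := by
  have := IsKilling.baseChange ℂ 𝔤 (K := ℝ)
  have hs := isSemisimple_of_iSup_eigenspace_eq_top h
  unfold IsSemisimpleMap
  rw [complexify_toEnd]
  exact (LieModule.isSemisimple_toEnd_of_isSemisimple_ad
    (by rw [← complexify_ad]; exact hs)).iSup_eigenspace_eq_top

theorem map_eq_zero_of_hasEigenvalue_complexify_toEnd {A : Type*} [AddCommGroup A]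
    [IsAddTorsionFree A] (F : ℂ →+ A) {x : 𝔤}
    (hF : ∀ μ, (complexify (ad ℝ 𝔤 x)).HasEigenvalue μ → F μ = 0) {μ : ℂ}
    (hμ : (complexify (LieModule.toEnd ℝ 𝔤 M x)).HasEigenvalue μ) : F μ = 0 := by
  have := IsKilling.baseChange ℂ 𝔤 (K := ℝ)
  rw [complexify_toEnd] at hμ
  refine LieModule.map_eq_zero_of_hasEigenvalue_toEnd F (fun μ hμ ↦ hF μ ?_) hμ
  rwa [complexify_ad]

theorem isNilpotent_toEnd_of_isNilpotent_ad {x : 𝔤} (h : IsNilpotent (ad ℝ 𝔤 x)) :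
    IsNilpotent (LieModule.toEnd ℝ 𝔤 M x) := by
  suffices IsNilpotent (complexify (LieModule.toEnd ℝ 𝔤 M x)) from
    (IsNilpotent.map_iff complexify_injective (f := Module.End.baseChangeHom ℝ ℂ M)).mp this
  exact isNilpotent_of_forall_hasEigenvalue_eq_zero fun μ hμ ↦
    map_eq_zero_of_hasEigenvalue_complexify_toEnd (AddMonoidHom.id ℂ)
      (fun ν hν ↦ (hν.isNilpotent_of_isNilpotent h.complexify).eq_zero) hμ

/-- Every representation of a semisimple Lie algebra maps abstract Jordan decompositions to linear
ones. -/
theorem IsAbstractJordanDecomposition.toEnd {X E H N : 𝔤}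
    (h : IsAbstractJordanDecomposition X E H N) :
    IsLinearJordanDecomposition (LieModule.toEnd ℝ 𝔤 M X) (LieModule.toEnd ℝ 𝔤 M E)
      (LieModule.toEnd ℝ 𝔤 M H) (LieModule.toEnd ℝ 𝔤 M N) where
  sum_eq := by rw [h.sum_eq, map_add, map_add]
  commute_EH := by rw [commute_iff_lie_eq, ← LieHom.map_lie, h.commute_EH, map_zero]
  commute_EN := by rw [commute_iff_lie_eq, ← LieHom.map_lie, h.commute_EN, map_zero]
  commute_HN := by rw [commute_iff_lie_eq, ← LieHom.map_lie, h.commute_HN, map_zero]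
  elliptic := ⟨h.elliptic.1.toEnd_of_ad, fun _ ↦
    map_eq_zero_of_hasEigenvalue_complexify_toEnd Complex.reAddGroupHom h.elliptic.2⟩
  hyperbolic := ⟨h.hyperbolic.1.toEnd_of_ad, fun _ ↦
    map_eq_zero_of_hasEigenvalue_complexify_toEnd Complex.imAddGroupHom h.hyperbolic.2⟩
  nilpotent := isNilpotent_toEnd_of_isNilpotent_ad h.nilpotent

end Abstract

theorem mainTheorem5 {V : Type*} [AddCommGroup V] [Module ℝ V] [FiniteDimensional ℝ V]
    (𝔤 : LieSubalgebra ℝ (Module.End ℝ V)) (h𝔤 : LieAlgebra.HasTrivialRadical ℝ 𝔤) (X : 𝔤) :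
    -- the usual and the abstract decompositions of `X` are the same triples
    (∀ E H N : Module.End ℝ V,
      IsLinearJordanDecomposition (X : Module.End ℝ V) E H N ↔
        ∃ (hE : E ∈ 𝔤) (hH : H ∈ 𝔤) (hN : N ∈ 𝔤),
          IsAbstractJordanDecomposition X (⟨E, hE⟩ : 𝔤) (⟨H, hH⟩ : 𝔤) (⟨N, hN⟩ : 𝔤)) ∧
    -- the usual decomposition exists and is unique
    (∃! p : Module.End ℝ V × Module.End ℝ V × Module.End ℝ V,
      IsLinearJordanDecomposition (X : Module.End ℝ V) p.1 p.2.1 p.2.2) ∧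
    -- the abstract decomposition exists and is unique
    (∃! p : 𝔤 × 𝔤 × 𝔤, IsAbstractJordanDecomposition X p.1 p.2.1 p.2.2) := by
  -- the action of `x : 𝔤` on the module `V` is the endomorphism `x` itself
  have linear {E H N : 𝔤} (h : IsAbstractJordanDecomposition X E H N) :
      IsLinearJordanDecomposition (X : Module.End ℝ V) E H N := h.toEnd (M := V)
  obtain ⟨E, H, N, h⟩ := exists_isAbstractJordanDecomposition X
  refine ⟨fun E' H' N' ↦ ⟨fun h' ↦ ?_, fun ⟨_, _, _, h'⟩ ↦ linear h'⟩,
    ⟨(E, H, N), linear h, fun p hp ↦ ?_⟩, ⟨(E, H, N), h, fun p hp ↦ ?_⟩⟩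
  · obtain ⟨rfl, rfl, rfl⟩ := (linear h).unique h'
    exact ⟨E.2, H.2, N.2, h⟩
  · obtain ⟨h1, h2, h3⟩ := hp.unique (linear h)
    exact Prod.ext h1 (Prod.ext h2 h3)
  · obtain ⟨h1, h2, h3⟩ := hp.unique h
    exact Prod.ext h1 (Prod.ext h2 h3)
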